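/- Let $A$ be an artin algebra (an algebra over a commutative artinian ring $R$ that is finitely generated as an $R$-module), let $\mathrm{proj}\,A$ be the category of finitely generated projective $A$-modules, and let $n\ge 1$ be an integer. For integers $m\le n$ let $\mathbf{C}_{[m,n]}(\mathrm{proj}\,A)$ be the full subcategory of the category of cochain complexes of $A$-modules consisting of the complexes $(X^i,d_X^i)_{i\in\mathbb{Z}}$ with $X^i\in\mathrm{proj}\,A$ for all $i$ and $X^i=0$ for $i\notin\{m,\dots,n\}$; write $\mathbf{C}_n(\mathrm{proj}\,A)=\mathbf{C}_{[1,n]}(\mathrm{proj}\,A)$, viewed as a full subcategory of $\mathbf{C}_{[0,n]}(\mathrm{proj}\,A)$. Let $F:\mathbf{C}_{[0,n]}(\mathrm{proj}\,A)\to\mathbf{C}_n(\mathrm{proj}\,A)$ be the hard truncation functor, which replaces the term in degree $0$ by zero. If $X$ is an indecomposable complex in $\mathbf{C}_n(\mathrm{proj}\,A)$, a left enlargement of $X$ is an indecomposable complex $Z$ in $\mathbf{C}_{[0,n]}(\mathrm{proj}\,A)$ such that $Z^0\neq 0$ and $X$ is a direct summand of $F(Z)$. A morphism $f$ of a category is irreducible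 if it is neither a section nor a retraction and, whenever $f=hg$, either $g$ is a section or $h$ is a retraction. Let $X$ be an indecomposable complex in $\mathbf{C}_n(\mathrm{proj}\,A)$, let $\overleftarrow{X}$ be a left enlargement of $X$, and let $f:X\to\overleftarrow{X}$ be an irreducible morphism in $\mathbf{C}_{[0,n]}(\mathrm{proj}\,A)$. Assume that $\overleftarrow{X}$ has the diagonal form $$Z^0\xrightarrow{\begin{pmatrix}\widetilde d_X^{\,0}\\ \widetilde d_Y^{\,0}\end{pmatrix}}X^1\oplus Y^1\xrightarrow{\begin{pmatrix}d_X^1&0\\0&d_Y^1\end{pmatrix}}X^2\oplus Y^2\longrightarrow\cdots\xrightarrow{\begin{pmatrix}d_X^{n-1}&0\\0&d_Y^{n-1}\end{pmatrix}}X^n\oplus Y^n$$ for some complex $Y$ in $\mathbf{C}_n(\mathrm{proj}\,A)$. Then the socle $\mathrm{soc}(\mathrm{Ker}\,d_X^1)$, where $d_X^1:X^1\to X^2$, has a projective cover, and $Z^0$ is a direct summand of it. -/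

import Mathlib

open CategoryTheory CategoryTheory.Limits

universe u v w

namespace ProjComplexes

/-! ### General categorical notions -/

section Category

variable {C : Type v} [Category.{w} C]

/-- A morphism `f : X ⟶ Y` is *irreducible* if it is neither a section (split monomorphism) nor
a retraction (split epimorphism), and in every factorization `f = h ∘ g` either `g` is a section
or `h` is a retraction. -/
structure IsIrreducible {X Y : C} (f : X ⟶ Y) : Prop where
  not_section : ¬ IsSplitMono f
  not_retraction : ¬ IsSplitEpi f
  factor : ∀ {W : C} (g : X ⟶ W) (h : W ⟶ Y), g ≫ h = f → IsSplitMono g ∨ IsSplitEpi h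

/-- `X` is a *direct summand* of `Z` if `Z ≅ X ⊞ Y` for some object `Y`. -/
def IsDirectSummand [HasZeroMorphisms C] [HasBinaryBiproducts C] (X Z : C) : Prop :=
  ∃ Y : C, Nonempty (Z ≅ X ⊞ Y)

end Category

/-! ### Modules: socle and projective cover -/

section Module

variable (A : Type u) [Ring A]

/-- The socle of a module: the sum of its simple submodules. -/
def socle (M : Type v) [AddCommGroup M] [Module A M] : Submodule A M :=
  sSup {S : Submodule A M | IsSimpleModule A S}

variable {A}

/-- `π : P → M` is a *projective cover* of `M`: `P` is projective, `π` is surjective and the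
kernel of `π` is superfluous (small) in `P`. -/
structure IsProjectiveCover {P : Type v} [AddCommGroup P] [Module A P]
    {M : Type w} [AddCommGroup M] [Module A M] (π : P →ₗ[A] M) : Prop where
  projective : Module.Projective A P
  surjective : Function.Surjective π
  superfluous : ∀ N : Submodule A P, N ⊔ LinearMap.ker π = ⊤ → N = ⊤

end Module

/-! ### Complexes of fixed size -/

section Complexes

variable (A : Type u) [Ring A]

/-- The complexes of finitely generated projective `A`-modules that are concentrated in the
degrees of the interval `[m, n]`. -/
def projComplex (m n : ℤ) : ObjectProperty (CochainComplex (ModuleCat.{u} A) ℤ) := fun X =>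
  (∀ i : ℤ, Module.Finite A (X.X i) ∧ Module.Projective A (X.X i)) ∧
    ∀ i : ℤ, i ∉ Set.Icc m n → IsZero (X.X i)

/-- The category `C_[m,n](proj A)`, as a full subcategory of the category of complexes of
`A`-modules. The category `C_n(proj A)` is `Cplx A 1 n`. -/
abbrev Cplx (m n : ℤ) : Type (u + 1) := (projComplex A m n).FullSubcategory

variable {A}

lemma projComplex_biprod {m n : ℤ} {X Y : CochainComplex (ModuleCat.{u} A) ℤ}
    (hX : projComplex A m n X) (hY : projComplex A m n Y) : projComplex A m n (X ⊞ Y) := by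
  refine ⟨fun i => ?_, fun i hi => ?_⟩
  · have e : (X ⊞ Y).X i ≃ₗ[A] (X.X i × Y.X i) :=
      (HomologicalComplex.biprodXIso X Y i ≪≫ ModuleCat.biprodIsoProd _ _).toLinearEquiv
    obtain ⟨h₁, h₂⟩ := hX.1 i
    obtain ⟨h₃, h₄⟩ := hY.1 i
    exact ⟨Module.Finite.equiv e.symm, Module.Projective.of_equiv e.symm⟩
  · exact IsZero.of_iso ((biprod_isZero_iff _ _).2 ⟨hX.2 i hi, hY.2 i hi⟩)
      (HomologicalComplex.biprodXIso X Y i)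

instance (m n : ℤ) : HasBinaryBiproducts (Cplx A m n) where
  has_binary_biproduct X Y :=
    let P : Cplx A m n := ⟨X.obj ⊞ Y.obj, projComplex_biprod X.property Y.property⟩
    hasBinaryBiproduct_of_total
      { pt := P
        fst := ObjectProperty.homMk (X := P) (Y := X) biprod.fst
        snd := ObjectProperty.homMk (X := P) (Y := Y) biprod.snd
        inl := ObjectProperty.homMk (X := X) (Y := P) biprod.inl
        inr := ObjectProperty.homMk (X := Y) (Y := P) biprod.inr
        inl_fst := ObjectProperty.hom_ext _ biprod.inl_fst
        inl_snd := ObjectProperty.hom_ext _ biprod.inl_snd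
        inr_fst := ObjectProperty.hom_ext _ biprod.inr_fst
        inr_snd := ObjectProperty.hom_ext _ biprod.inr_snd }
      (ObjectProperty.hom_ext _ biprod.total)

variable (A) in
lemma projComplex_le (n : ℤ) : projComplex A 1 n ≤ projComplex A 0 n := fun _ hX =>
  ⟨hX.1, fun i hi => hX.2 i fun h => hi ⟨by linarith [h.1], h.2⟩⟩

variable (A) in
/-- The inclusion of `C_n(proj A)` into `C_[0,n](proj A)`. -/
abbrev incl (n : ℤ) : Cplx A 1 n ⥤ Cplx A 0 n :=
  ObjectProperty.ιOfLE (projComplex_le A n)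

lemma projComplex_stupidTrunc {n : ℤ} {Z : CochainComplex (ModuleCat.{u} A) ℤ}
    (hZ : projComplex A 0 n Z) :
    projComplex A 1 n (Z.stupidTrunc (ComplexShape.embeddingUpIntGE 1)) := by
  have key : ∀ i : ℤ, (Nonempty ((Z.stupidTrunc (ComplexShape.embeddingUpIntGE 1)).X i ≅ Z.X i)) ∨
      (i < 1 ∧ IsZero ((Z.stupidTrunc (ComplexShape.embeddingUpIntGE 1)).X i)) := by
    intro i
    by_cases hi : 1 ≤ i
    · obtain ⟨k, hk⟩ := Int.eq_ofNat_of_zero_le (sub_nonneg.2 hi)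
      exact Or.inl ⟨Z.stupidTruncXIso (ComplexShape.embeddingUpIntGE 1) (i := k)
        (by simp; omega)⟩
    · exact Or.inr ⟨not_le.1 hi, Z.isZero_stupidTrunc_X _ i (fun k => by simp; omega)⟩
  refine ⟨fun i => ?_, fun i hi => ?_⟩
  · obtain ⟨⟨e⟩⟩ | ⟨-, h⟩ := key i
    · obtain ⟨h₁, h₂⟩ := hZ.1 i
      exact ⟨Module.Finite.equiv e.symm.toLinearEquiv,
        Module.Projective.of_equiv e.symm.toLinearEquiv⟩
    · have := ModuleCat.subsingleton_of_isZero h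
      exact ⟨inferInstance, inferInstance⟩
  · obtain ⟨⟨e⟩⟩ | ⟨-, h⟩ := key i
    · by_cases hi₀ : 1 ≤ i
      · exact IsZero.of_iso (hZ.2 i fun h => hi ⟨hi₀, h.2⟩) e
      · exact Z.isZero_stupidTrunc_X _ i (fun k => by simp; omega)
    · exact h

variable (A) in
/-- The hard truncation functor `F : C_[0,n](proj A) ⥤ C_n(proj A)`, which replaces the term in
degree `0` by zero and keeps the terms and differentials in degrees `≥ 1`. -/
noncomputable def hardTrunc (n : ℤ) : Cplx A 0 n ⥤ Cplx A 1 n :=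
  (projComplex A 1 n).lift
    ((projComplex A 0 n).ι ⋙
      (ComplexShape.embeddingUpIntGE 1).stupidTruncFunctor (ModuleCat.{u} A))
    fun Z => projComplex_stupidTrunc Z.property

/-- `Z` in `C_[0,n](proj A)` is a *left enlargement* of the (indecomposable) complex `X` in
`C_n(proj A)`: `Z` is indecomposable, `Z⁰ ≠ 0`, and `X` is a direct summand of the hard truncation
of `Z` in `C_n(proj A)`. -/
structure IsLeftEnlargement {n : ℤ} (X : Cplx A 1 n) (Z : Cplx A 0 n) : Prop where
  indecomposable : Indecomposable Z
  ne_zero : ¬ IsZero (Z.obj.X 0)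
  summand : IsDirectSummand X ((hardTrunc A n).obj Z)

/-- The data that present `Z` as a diagonal complex
`Z⁰ ⟶ X¹ ⊞ Y¹ ⟶ X² ⊞ Y² ⟶ ⋯ ⟶ Xⁿ ⊞ Yⁿ`: the first differential has components
`dX` and `dY`, and the differential in each degree `i ≥ 1` is the diagonal matrix with entries the
differentials of `X` and of `Y`. -/
structure DiagonalForm {n : ℤ} (X Y : Cplx A 1 n) (Z : Cplx A 0 n) where
  /-- the identification of `Zⁱ` with `Xⁱ ⊞ Yⁱ` for `i ≥ 1` -/
  iso : ∀ i : ℤ, 1 ≤ i → (Z.obj.X i ≅ X.obj.X i ⊞ Y.obj.X i)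
  /-- the component `Z⁰ ⟶ X¹` of the first differential -/
  dX : Z.obj.X 0 ⟶ X.obj.X 1
  /-- the component `Z⁰ ⟶ Y¹` of the first differential -/
  dY : Z.obj.X 0 ⟶ Y.obj.X 1
  d_zero : Z.obj.d 0 1 ≫ (iso 1 le_rfl).hom = biprod.lift dX dY
  d_pos : ∀ (i : ℤ) (hi : 1 ≤ i),
    Z.obj.d i (i + 1) ≫ (iso (i + 1) (by omega)).hom =
      (iso i hi).hom ≫ biprod.map (X.obj.d i (i + 1)) (Y.obj.d i (i + 1))

/-- The socle of the kernel of the differential `d¹ : X¹ ⟶ X²`. -/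
abbrev socKer {n : ℤ} (X : Cplx A 1 n) :
    Submodule A (LinearMap.ker (X.obj.d 1 2).hom) :=
  socle A (LinearMap.ker (X.obj.d 1 2).hom)

end Complexes

end ProjComplexes

/-! Let `K` be the kernel of `X¹ → X²`. It suffices that `soc K` surjects onto the top of `Z⁰`: a
projective cover of `soc K` then maps onto that top, the map lifts to `Z⁰`, and the lift is onto by
Nakayama and splits.

Let `Φ` be the set of maps `Z⁰ → K` obtained by composing `d⁰` with a left inverse, defined in
degrees `≥ 1`, of `f`. It is a coset of a subgroup of `Hom(Z⁰, K)`, and `0 ∉ Φ` because `f` is not a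
section. Replacing `Z⁰` by a projective mapping onto a proper submodule `N` factors `f`; the second
factor cannot be a retraction, so the first is a section, and some member of `Φ` kills `N`
(`IsIrreducible.exists_isTailMap`).

With `N` the radical, a member of `Φ` becomes a map from `V = top Z⁰` to `W = soc K` that avoids a
submodule `H` of `Hom(V, W)` but agrees with elements of `H` on each proper submodule of `V`.
Separate it from `H` by a functional with simple values. By a length count
(`exists_linearMap_of_functional`) that functional kills every map vanishing on the image of some `s
: W → V`. Were `s` not onto, agreement on its image would contradict the separation. -/

namespace ProjComplexes

/-! ### Duality between `Hom(V, W)` and `Hom(W, V)` for semisimple modules -/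

section Pairing

variable {R : Type*} [CommRing R]

/-- Homomorphisms into a simple module do not increase the length. -/
lemma length_linearMap_le_of_isSimpleModule {L : Type*} [AddCommGroup L] [Module R L]
    [IsSimpleModule R L] {Q : Type*} [AddCommGroup Q] [Module R Q] (hQ : IsFiniteLength R Q) :
    Module.length R (Q →ₗ[R] L) ≤ Module.length R Q := by
  induction hQ with
  | of_subsingleton => rw [Module.length_eq_zero]; exact zero_le
  | @of_simple_quotient M _ _ N hN _ ih =>
    -- Evaluation at a generator of the simple quotient embeds this Hom in `L`.
    have hquot : Module.length R ((M ⧸ N) →ₗ[R] L) ≤ 1 := by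
      obtain ⟨q, hq⟩ := @exists_ne _ (IsSimpleModule.nontrivial R (M ⧸ N)) 0
      rw [← Module.length_eq_one R L]
      refine Module.length_le_of_injective (LinearMap.applyₗ q) fun f g hfg => ?_
      refine LinearMap.ext_on (s := {q}) (IsSimpleModule.span_singleton_eq_top R hq) ?_
      rintro _ rfl
      exact hfg
    have hexact := LinearMap.exact_lcomp_of_exact_of_surjective (N := L)
      (LinearMap.exact_subtype_mkQ N) N.mkQ_surjective
    rw [Module.length_eq_add_of_exact (M := M) N.subtype N.mkQ N.injective_subtype
      N.mkQ_surjective (LinearMap.exact_subtype_mkQ N), Module.length_eq_one R (M ⧸ N),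
      Module.length_eq_add_of_exact (LinearMap.lcomp R L N.mkQ)
        (LinearMap.lcomp R L N.subtype).rangeRestrict
        (LinearMap.lcomp_injective_of_surjective _ N.mkQ_surjective)
        (LinearMap.surjective_rangeRestrict _)
        (fun x => by rw [← hexact x, Subtype.ext_iff]; rfl), add_comm]
    exact add_le_add ((Module.length_le_of_injective _ (Submodule.injective_subtype _)).trans ih)
      hquot

variable {A : Type*} [Ring A] [Algebra R A]

instance isNoetherian_linearMap_of_algebra [IsNoetherianRing R] (M N : Type*) [AddCommGroup M]
    [Module A M] [Module R M] [IsScalarTower R A M] [AddCommGroup N] [Module A N] [Module R N]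
    [IsScalarTower R A N] [Module.Finite R M] [Module.Finite R N] :
    IsNoetherian R (M →ₗ[A] N) :=
  isNoetherian_of_injective (LinearMap.restrictScalarsₗ R A M N R)
    (LinearMap.restrictScalars_injective R)

/-- Nilpotent scalars annihilate semisimple modules over an algebra. -/
lemma smul_eq_zero_of_isNilpotent {W : Type*} [AddCommGroup W] [Module A W] [Module R W]
    [IsScalarTower R A W] [IsSemisimpleModule A W] {r : R} (hr : IsNilpotent r) (w : W) :
    r • w = 0 := by
  suffices h : (⊤ : Submodule A W) ≤
      LinearMap.ker (r • LinearMap.id : W →ₗ[A] W) from LinearMap.mem_ker.1 (h trivial)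
  rw [← IsSemisimpleModule.sSup_simples_eq_top A W]
  refine sSup_le fun S (hS : IsSimpleModule A S) => ?_
  obtain ⟨k, hk⟩ := hr
  have hpow : ∀ j : ℕ, (r • LinearMap.id : S →ₗ[A] S) ^ j = r ^ j • LinearMap.id := by
    intro j
    change (r • (1 : Module.End A S)) ^ j = r ^ j • (1 : Module.End A S)
    rw [smul_pow, one_pow]
  -- By Schur a nonzero endomorphism of `S` has injective powers, but this one is nilpotent.
  have hzero : (r • LinearMap.id : S →ₗ[A] S) = 0 := by
    by_contra hne
    have hb := LinearMap.injective_of_ne_zero hne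
    have hb' : Function.Injective ((r • LinearMap.id : S →ₗ[A] S) ^ k) := by
      rw [Module.End.coe_pow]
      exact hb.iterate k
    rw [hpow, hk, zero_smul] at hb'
    obtain ⟨x, hx⟩ := @exists_ne _ (IsSimpleModule.nontrivial A S) 0
    exact hx (hb' (by simp))
  intro x hx
  have h := LinearMap.congr_fun hzero ⟨x, hx⟩
  simpa [Subtype.ext_iff] using h

variable [IsArtinianRing R]

/-- Every functional on `Hom(V, S)`, with `S` simple, is controlled by a map `S → V`. -/
lemma exists_linearMap_of_functional {V S : Type*} [AddCommGroup V] [Module A V] [Module R V]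
    [IsScalarTower R A V] [Module.Finite R V] [IsSemisimpleModule A V]
    [AddCommGroup S] [Module A S] [Module R S] [IsScalarTower R A S] [Module.Finite R S]
    [IsSimpleModule A S] {L : Type*} [AddCommGroup L] [Module R L] [IsSimpleModule R L]
    (l : (V →ₗ[A] S) →ₗ[R] L) :
    ∃ s : S →ₗ[A] V, ∀ φ : V →ₗ[A] S, φ ∘ₗ s = 0 → l φ = 0 := by
  by_cases hl : l = 0
  · exact ⟨0, fun φ _ => by rw [hl]; rfl⟩
  obtain ⟨φ₀, hφ₀⟩ : ∃ φ₀, l φ₀ ≠ 0 := by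
    by_contra! h
    exact hl (LinearMap.ext h)
  let t : (S →ₗ[A] S) →ₗ[R] L := l ∘ₗ LinearMap.lcomp R S φ₀
  have ht : t LinearMap.id ≠ 0 := hφ₀
  -- This pairing is nondegenerate on both sides: a nonzero map from or to `S` splits, so some
  -- composite is the identity, where `t` does not vanish.
  let B : (S →ₗ[A] V) →ₗ[R] (V →ₗ[A] S) →ₗ[R] L :=
    LinearMap.mk₂ R (fun s φ => t (φ ∘ₗ s))
      (fun s s' φ => by rw [LinearMap.comp_add, map_add])
      (fun c s φ => by rw [LinearMap.comp_smul, map_smul])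
      (fun s φ φ' => by rw [LinearMap.add_comp, map_add])
      (fun c s φ => by rw [LinearMap.smul_comp, map_smul])
  have hB : Function.Injective B := by
    refine (injective_iff_map_eq_zero B).2 fun s hs => ?_
    by_contra hne
    obtain ⟨φ, hφ⟩ := IsSemisimpleModule.extension_property s
      (LinearMap.injective_of_ne_zero hne) LinearMap.id
    refine ht ?_
    rw [← hφ]
    exact LinearMap.congr_fun hs φ
  have hB' : Function.Injective B.flip := by
    refine (injective_iff_map_eq_zero B.flip).2 fun φ hφ => ?_
    by_contra hne
    obtain ⟨s, hs⟩ := IsSemisimpleModule.lifting_property φ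
      (LinearMap.surjective_of_ne_zero hne) LinearMap.id
    refine ht ?_
    rw [← hs]
    exact LinearMap.congr_fun hφ s
  have hP : IsFiniteLength R (S →ₗ[A] V) :=
    isFiniteLength_iff_isNoetherian_isArtinian.2 ⟨inferInstance, inferInstance⟩
  have hQ : IsFiniteLength R (V →ₗ[A] S) :=
    isFiniteLength_iff_isNoetherian_isArtinian.2 ⟨inferInstance, inferInstance⟩
  -- Nondegeneracy gives a cycle of inequalities among the lengths of the two Hom modules and their
  -- `L`-duals, so all are equal.
  have hsurj : LinearMap.range B = ⊤ := by
    by_contra hne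
    have hlt := Submodule.length_lt hne
    rw [← (LinearEquiv.ofInjective B hB).length_eq] at hlt
    exact (hlt.trans_le ((length_linearMap_le_of_isSimpleModule hQ).trans
      ((Module.length_le_of_injective _ hB').trans
        (length_linearMap_le_of_isSimpleModule hP)))).false
  obtain ⟨s, hs⟩ := LinearMap.range_eq_top.1 hsurj l
  refine ⟨s, fun φ hφ => ?_⟩
  rw [← hs]
  change t (φ ∘ₗ s) = 0
  rw [hφ, map_zero]

/-- Every functional on `Hom(V, W)`, with `V` and `W` semisimple, is controlled by a map
`W → V`. -/
lemma exists_linearMap_of_functional_of_isSemisimpleModule {V W : Type*} [AddCommGroup V]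
    [Module A V] [Module R V]
    [IsScalarTower R A V] [Module.Finite R V] [IsSemisimpleModule A V]
    [AddCommGroup W] [Module A W] [Module R W] [IsScalarTower R A W] [Module.Finite R W]
    [Module.Finite A W]
    [IsSemisimpleModule A W] {L : Type*} [AddCommGroup L] [Module R L] [IsSimpleModule R L]
    (l : (V →ₗ[A] W) →ₗ[R] L) :
    ∃ s : W →ₗ[A] V, ∀ φ : V →ₗ[A] W, φ ∘ₗ s = 0 → l φ = 0 := by
  classical
  obtain ⟨n, S, e, hS⟩ := IsSemisimpleModule.exists_linearEquiv_fin_dfinsupp A W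
  let i : ∀ j, S j →ₗ[A] W := fun j => e.symm.toLinearMap ∘ₗ DFinsupp.lsingle (M := fun j => S j) j
  let p : ∀ j, W →ₗ[A] S j := fun j => DFinsupp.lapply (M := fun j => S j) j ∘ₗ e.toLinearMap
  have hpi : ∀ j k, j ≠ k → p k ∘ₗ i j = 0 := fun j k hjk => by
    ext x
    simp [p, i, DFinsupp.single_eq_of_ne hjk.symm]
  have hpi' : ∀ j, p j ∘ₗ i j = LinearMap.id := fun j => by
    ext x
    simp [p, i]
  have hsum : ∑ j, i j ∘ₗ p j = LinearMap.id := by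
    ext x
    apply e.injective
    simp only [LinearMap.sum_apply, map_sum, LinearMap.comp_apply, i, p]
    simp only [LinearEquiv.coe_coe, LinearEquiv.apply_symm_apply, LinearMap.id_apply]
    ext k
    simp [DFinsupp.single_apply]
  have hfin : ∀ j, Module.Finite R (S j) := fun j =>
    Module.Finite.of_surjective ((p j).restrictScalars R) fun y =>
      ⟨i j y, LinearMap.congr_fun (hpi' j) y⟩
  have key : ∀ j, ∃ s : S j →ₗ[A] V, ∀ φ : V →ₗ[A] S j, φ ∘ₗ s = 0 → l (i j ∘ₗ φ) = 0 :=
    fun j =>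
      exists_linearMap_of_functional
        (l ∘ₗ { toFun := fun φ => i j ∘ₗ φ
                map_add' := fun _ _ => LinearMap.comp_add _ _ _
                map_smul' := fun c φ => LinearMap.comp_smul (i j) c φ })
  choose s hs using key
  refine ⟨∑ j, s j ∘ₗ p j, fun φ hφ => ?_⟩
  have hφs : ∀ j, φ ∘ₗ s j = 0 := fun j => by
    ext x
    have h := LinearMap.congr_fun hφ (i j x)
    have hx : (∑ k, s k ∘ₗ p k) (i j x) = s j x := by
      rw [LinearMap.sum_apply, Finset.sum_eq_single j]
      · exact congrArg (s j) (LinearMap.congr_fun (hpi' j) x)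
      · intro k _ hk
        rw [LinearMap.comp_apply, ← LinearMap.comp_apply (p k), hpi j k hk.symm]
        simp
      · simp
    rwa [LinearMap.comp_apply, hx] at h
  have hφ' : φ = ∑ j, i j ∘ₗ (p j ∘ₗ φ) := by
    ext v
    rw [LinearMap.sum_apply]
    simpa using (LinearMap.congr_fun hsum (φ v)).symm
  rw [hφ', map_sum]
  exact Finset.sum_eq_zero fun j _ => hs j _ (by rw [LinearMap.comp_assoc, hφs, LinearMap.comp_zero])

/-- The radical of the artinian ring `R` is nilpotent, so `M` is a module over the semisimple
quotient. -/
lemma isSemisimpleModule_of_isNilpotent_smul {M : Type*} [AddCommGroup M] [Module R M]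
    (h : ∀ r : R, IsNilpotent r → ∀ m : M, r • m = 0) : IsSemisimpleModule R M := by
  have htors : Module.IsTorsionBySet R M (Ring.jacobson R : Set R) := by
    rintro m ⟨r, hr⟩
    refine h r ?_ m
    obtain ⟨k, hk⟩ := IsSemiprimaryRing.isNilpotent (R := R)
    exact ⟨k, by simpa [hk] using Ideal.pow_mem_pow hr k⟩
  let := htors.module
  exact htors.isSemisimpleModule_iff.1 inferInstance

/-- If a homomorphism `φ : V → W` of semisimple modules does not belong to the submodule `H` of
`Hom(V, W)`, but agrees with an element of `H` on every proper submodule of `V`, then `V` is a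
quotient of `W`. -/
lemma exists_surjective_of_agree_on_proper {V W : Type*} [AddCommGroup V]
    [Module A V] [Module R V]
    [IsScalarTower R A V] [Module.Finite R V] [IsSemisimpleModule A V]
    [AddCommGroup W] [Module A W] [Module R W] [IsScalarTower R A W] [Module.Finite R W]
    [Module.Finite A W] [IsSemisimpleModule A W] (H : Submodule R (V →ₗ[A] W)) (φ : V →ₗ[A] W)
    (hφ : φ ∉ H) (hH : ∀ N : Submodule A V, N ≠ ⊤ → ∃ ψ ∈ H, ∀ x ∈ N, φ x = ψ x) :
    ∃ s : W →ₗ[A] V, Function.Surjective s := by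
  have hss : IsSemisimpleModule R ((V →ₗ[A] W) ⧸ H) := by
    refine isSemisimpleModule_of_isNilpotent_smul fun r hr m => ?_
    obtain ⟨ψ, rfl⟩ := H.mkQ_surjective m
    rw [← map_smul]
    convert map_zero H.mkQ
    ext v
    exact smul_eq_zero_of_isNilpotent (A := A) hr (ψ v)
  -- Zero radical provides a maximal submodule missing the class of `φ`; its quotient is the simple
  -- target of the functional.
  have hne : H.mkQ φ ∉ Module.jacobson R ((V →ₗ[A] W) ⧸ H) := by
    rw [IsSemisimpleModule.jacobson_eq_bot]
    simpa using hφ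
  rw [Module.jacobson, Submodule.mem_sInf] at hne
  push Not at hne
  obtain ⟨M, hM, hφM⟩ := hne
  have := isSimpleModule_iff_isCoatom.2 hM
  obtain ⟨s, hs⟩ := exists_linearMap_of_functional_of_isSemisimpleModule (M.mkQ ∘ₗ H.mkQ)
  refine ⟨s, ?_⟩
  by_contra hsurj
  rw [← LinearMap.range_eq_top] at hsurj
  obtain ⟨ψ, hψ, hagree⟩ := hH _ hsurj
  refine hφM ?_
  have hzero := hs (φ - ψ) (by
    ext w
    simp [hagree (s w) ⟨w, rfl⟩])
  rw [map_sub, sub_eq_zero] at hzero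
  have hψ0 : H.mkQ ψ = 0 := by simpa using hψ
  rw [LinearMap.comp_apply, LinearMap.comp_apply, hψ0, map_zero] at hzero
  simpa using hzero

end Pairing

/-! ### Socles, tops and projective covers -/

section Socle

variable (A : Type*) [Ring A] (M : Type*) [AddCommGroup M] [Module A M]

instance isSemisimpleModule_socle : IsSemisimpleModule A (socle A M) := by
  rw [socle, sSup_eq_iSup]
  exact isSemisimpleModule_biSup_of_isSemisimpleModule_submodule
    fun S (_ : IsSimpleModule A S) => inferInstance

variable {A M}

lemma le_socle (N : Submodule A M) [IsSemisimpleModule A N] : N ≤ socle A M := by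
  suffices h : (⊤ : Submodule A N) ≤ (socle A M).comap N.subtype from
    fun x hx => h (x := ⟨x, hx⟩) trivial
  rw [← IsSemisimpleModule.sSup_simples_eq_top A N]
  refine sSup_le fun S (_ : IsSimpleModule A S) => Submodule.map_le_iff_le_comap.1 ?_
  exact le_sSup (IsSimpleModule.congr
    (Submodule.equivMapOfInjective N.subtype N.injective_subtype S).symm)

lemma isSemisimpleModule_quotient_jacobson [IsArtinian A M] :
    IsSemisimpleModule A (M ⧸ Module.jacobson A M) :=
  (IsArtinian.isSemisimpleModule_iff_jacobson A _).2 (Module.jacobson_quotient_jacobson A M)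

/-- A map into a finitely generated module that is onto modulo the radical is surjective. -/
lemma surjective_of_surjective_mkQ_jacobson [Module.Finite A M] {P : Type*} [AddCommGroup P]
    [Module A P] (h : P →ₗ[A] M)
    (hh : Function.Surjective ((Module.jacobson A M).mkQ ∘ₗ h)) : Function.Surjective h := by
  rw [← LinearMap.range_eq_top]
  by_contra hne
  obtain ⟨N, hN, hle⟩ := (eq_top_or_exists_le_coatom (LinearMap.range h)).resolve_left hne
  refine hN.1 (eq_top_iff.2 fun m _ => ?_)
  obtain ⟨p, hp⟩ := hh ((Module.jacobson A M).mkQ m)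
  have hmem : m - h p ∈ Module.jacobson A M := by
    rw [← Submodule.Quotient.mk_eq_zero, ← Submodule.mkQ_apply, map_sub, sub_eq_zero]
    exact hp.symm
  simpa using N.add_mem ((sInf_le hN : Module.jacobson A M ≤ N) hmem) (hle ⟨p, rfl⟩)

/-- Finitely generated modules over an artinian ring have projective covers. -/
lemma exists_isProjectiveCover {A : Type u} [Ring A] [IsArtinianRing A] {M : Type v}
    [AddCommGroup M] [Module A M] [Module.Finite A M] :
    ∃ (P : ModuleCat.{u} A) (π : P →ₗ[A] M), IsProjectiveCover π := by
  obtain ⟨n, p, hp⟩ := Module.Finite.exists_fin' A M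
  -- Minimality of `N` is used twice: it makes `N` a summand of the free module, and it makes the
  -- kernel superfluous.
  obtain ⟨N, hN, hmin⟩ := IsArtinian.set_has_minimal
    {N : Submodule A (Fin n → A) | N.map p = ⊤}
    ⟨⊤, by simpa [LinearMap.range_eq_top] using hp⟩
  have hmin' : ∀ N' ≤ N, N'.map p = ⊤ → N' = N := fun N' hle hN' => by
    by_contra hne
    exact hmin N' hN' (lt_of_le_of_ne hle hne)
  let q : N →ₗ[A] M := p ∘ₗ N.subtype
  have hq : Function.Surjective q := fun m => by
    obtain ⟨x, hx, rfl⟩ : m ∈ N.map p := (show N.map p = ⊤ from hN) ▸ trivial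
    exact ⟨⟨x, hx⟩, rfl⟩
  obtain ⟨g, hg⟩ := Module.projective_lifting_property q p hq
  have hsurj : Function.Surjective (g ∘ₗ N.subtype) := by
    have h := hmin' (LinearMap.range (N.subtype ∘ₗ g ∘ₗ N.subtype))
      (by rintro _ ⟨x, rfl⟩; exact (g x).2) (by
        rw [← LinearMap.range_comp, LinearMap.range_eq_top]
        intro m
        obtain ⟨x, rfl⟩ := hq m
        exact ⟨x, LinearMap.congr_fun hg x⟩)
    intro y
    obtain ⟨x, hx⟩ : (y : Fin n → A) ∈ LinearMap.range (N.subtype ∘ₗ g ∘ₗ N.subtype) := by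
      rw [h]; exact y.2
    exact ⟨x, Subtype.ext hx⟩
  have hbij := IsNoetherian.bijective_of_surjective_endomorphism _ hsurj
  let e := LinearEquiv.ofBijective _ hbij
  have hproj : Module.Projective A N :=
    Module.Projective.of_split N.subtype (e.symm.toLinearMap ∘ₗ g)
      (LinearMap.ext fun x => e.symm_apply_apply x)
  refine ⟨ModuleCat.of A N, q, hproj, hq, fun N' hN' => ?_⟩
  have h := hmin' (N'.map N.subtype) (Submodule.map_subtype_le N N') (by
    rw [← Submodule.map_comp, eq_top_iff]
    rintro m -
    obtain ⟨x, rfl⟩ := hq m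
    obtain ⟨y, hy, z, hz, rfl⟩ := Submodule.mem_sup.1 (hN' ▸ Submodule.mem_top : x ∈ N' ⊔ _)
    exact ⟨y, hy, by rw [map_add, LinearMap.mem_ker.1 hz, add_zero]⟩)
  refine eq_top_iff.2 fun x _ => ?_
  obtain ⟨y, hy, hyx⟩ : (x : Fin n → A) ∈ N'.map N.subtype := by
    rw [h]; exact x.2
  rwa [← Subtype.ext hyx]

/-- A family `Φ` of homomorphisms `M → K`, which is a coset of a submodule of `Hom(M, K)` that does
not contain zero, makes the top of `M` a quotient of the socle of `K` as soon as every proper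
submodule of `M` is annihilated by a member of `Φ`. -/
theorem exists_surjective_socle_quotient_jacobson {R : Type*} [CommRing R] [IsArtinianRing R]
    [Algebra R A] [Module.Finite R A] [Module R M] [IsScalarTower R A M] [Module.Finite A M]
    {K : Type*} [AddCommGroup K] [Module A K] [Module R K] [IsScalarTower R A K]
    [Module.Finite A K] (H : Submodule R (M →ₗ[A] K)) (Φ : Set (M →ₗ[A] K)) (h0 : 0 ∉ Φ)
    (hsub : ∀ φ ∈ Φ, ∀ ψ ∈ Φ, φ - ψ ∈ H) (hadd : ∀ φ ∈ Φ, ∀ ψ ∈ H, φ - ψ ∈ Φ)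
    (hΦ : ∀ N : Submodule A M, N ≠ ⊤ → ∃ φ ∈ Φ, N ≤ LinearMap.ker φ) :
    ∃ s : socle A K →ₗ[A] M ⧸ Module.jacobson A M, Function.Surjective s := by
  have : IsArtinianRing A := IsArtinianRing.of_finite R A
  have : Module.Finite R M := Module.Finite.trans A M
  have : Module.Finite R K := Module.Finite.trans A K
  have : IsSemisimpleModule A (M ⧸ Module.jacobson A M) := isSemisimpleModule_quotient_jacobson
  have : Module.Finite R (M ⧸ Module.jacobson A M) := Module.Finite.trans A _
  have : Module.Finite R (socle A K) := Module.Finite.trans A _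
  by_cases hM : Module.jacobson A M = ⊤
  · have : Subsingleton (M ⧸ Module.jacobson A M) := by
      rw [hM]; infer_instance
    exact ⟨0, fun y => ⟨0, Subsingleton.elim _ _⟩⟩
  -- The image is a quotient of the semisimple top, hence lies in the socle.
  have hlift : ∀ φ : M →ₗ[A] K, Module.jacobson A M ≤ LinearMap.ker φ →
      ∃ ψ : (M ⧸ Module.jacobson A M) →ₗ[A] socle A K,
        (socle A K).subtype ∘ₗ ψ ∘ₗ (Module.jacobson A M).mkQ = φ := fun φ hφ => by
    let φ' := (Module.jacobson A M).liftQ φ hφ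
    have : IsSemisimpleModule A (LinearMap.range φ') := IsSemisimpleModule.range φ'
    exact ⟨φ'.codRestrict (socle A K) fun v => le_socle (LinearMap.range φ') ⟨v, rfl⟩,
      LinearMap.ext fun x => rfl⟩
  let T : ((M ⧸ Module.jacobson A M) →ₗ[A] socle A K) →ₗ[R] M →ₗ[A] K :=
    { toFun := fun ψ => (socle A K).subtype ∘ₗ ψ ∘ₗ (Module.jacobson A M).mkQ
      map_add' := fun _ _ => rfl
      map_smul' := fun _ _ => rfl }
  obtain ⟨φ₀, hφ₀, hker₀⟩ := hΦ _ hM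
  obtain ⟨φ, hφ⟩ := hlift φ₀ hker₀
  refine exists_surjective_of_agree_on_proper (H.comap T) φ (fun h => h0 ?_) fun N hN => ?_
  · have h' := hadd φ₀ hφ₀ φ₀ (hφ ▸ h)
    rwa [sub_self] at h'
  · obtain ⟨φ₁, hφ₁, hker₁⟩ := hΦ (N.comap (Module.jacobson A M).mkQ) fun h => hN (by
      rw [← Submodule.map_comap_eq_of_surjective (Submodule.mkQ_surjective _) N, h,
        Submodule.map_top, Submodule.range_mkQ])
    obtain ⟨ψ, hψ⟩ := hlift φ₁ fun x hx => hker₁ (by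
      have hx0 : (Module.jacobson A M).mkQ x = 0 := by simpa using hx
      rw [Submodule.mem_comap, hx0]
      exact N.zero_mem)
    refine ⟨φ - ψ, ?_, fun x hx => ?_⟩
    · have hT : T (φ - ψ) = φ₀ - φ₁ := by rw [map_sub]; exact congrArg₂ _ hφ hψ
      rw [Submodule.mem_comap, hT]
      exact hsub _ hφ₀ _ hφ₁
    · obtain ⟨m, rfl⟩ := Submodule.mkQ_surjective _ x
      have hm : ψ ((Module.jacobson A M).mkQ m) = 0 := by
        apply Subtype.ext
        exact (LinearMap.congr_fun hψ m).trans (LinearMap.mem_ker.1 (hker₁ hx))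
      rw [LinearMap.sub_apply, hm, sub_zero]

/-- A projective module that surjects onto the top of a finitely generated projective module `M` has
`M` as a direct summand. -/
lemma isDirectSummand_of_surjective_quotient_jacobson {A : Type u} [Ring A] {M P : ModuleCat.{u} A}
    [Module.Finite A M] [Module.Projective A M] [Module.Projective A P]
    (q : P →ₗ[A] M ⧸ Module.jacobson A M) (hq : Function.Surjective q) :
    IsDirectSummand M P := by
  obtain ⟨h, hh⟩ := Module.projective_lifting_property (Module.jacobson A M).mkQ q
    (Submodule.mkQ_surjective _)
  have hsurj := surjective_of_surjective_mkQ_jacobson h (by rwa [hh])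
  obtain ⟨i, hi⟩ := Module.projective_lifting_property h LinearMap.id hsurj
  have hi' : ∀ m, h (i m) = m := LinearMap.congr_fun hi
  let e : P ≃ₗ[A] M × LinearMap.ker h :=
    { toFun := fun x => (h x, ⟨x - i (h x), by simp [hi']⟩)
      map_add' := fun x y => by
        ext <;> simp
        abel
      map_smul' := fun c x => by ext <;> simp [smul_sub]
      invFun := fun y => i y.1 + y.2
      left_inv := fun x => by simp
      right_inv := fun y => by ext <;> simp [hi'] }
  exact ⟨ModuleCat.of A (LinearMap.ker h),
    ⟨e.toModuleIso ≪≫ (ModuleCat.biprodIsoProd M (ModuleCat.of A (LinearMap.ker h))).symm⟩⟩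

end Socle

end ProjComplexes

namespace ProjComplexes

/-! ### Changing the degree-zero term -/

section Replacement

variable {A : Type u} [Ring A] {n : ℤ}

/-- The term in degree zero of a complex in `C_[0,n](proj A)` can be replaced by any finitely
generated projective module that maps to it. -/
lemma exists_replace_zero (hn : 1 ≤ n) (Z : Cplx A 0 n) {P : ModuleCat.{u} A} [Module.Finite A P]
    [Module.Projective A P] (p : P ⟶ Z.obj.X 0) :
    ∃ (W : Cplx A 0 n) (h : W ⟶ Z) (k : ∀ i, Z.obj.X i ⟶ W.obj.X i) (e : P ≅ W.obj.X 0),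
      e.hom ≫ h.hom.f 0 = p ∧
        ∀ i, i ≠ 0 → k i ≫ h.hom.f i = 𝟙 _ ∧ h.hom.f i ≫ k i = 𝟙 _ := by
  -- The value `k = 0` in degree zero is harmless: the differential entering that degree is zero
  -- anyway.
  have key : ∀ i : ℤ, ∃ (M : ModuleCat.{u} A) (a : M ⟶ Z.obj.X i) (k : Z.obj.X i ⟶ M),
      (i ≠ 0 → k ≫ a = 𝟙 _ ∧ a ≫ k = 𝟙 _) ∧
        ∀ h : i = 0, k = 0 ∧ ∃ e : P ≅ M, e.hom ≫ a = p ≫ eqToHom (by rw [h]) := by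
    intro i
    by_cases hi : i = 0
    · subst hi
      exact ⟨P, p, 0, fun h => absurd rfl h, fun _ => ⟨rfl, Iso.refl _, by simp⟩⟩
    · exact ⟨Z.obj.X i, 𝟙 _, 𝟙 _, fun _ => by simp, fun h => absurd h hi⟩
  choose M a k hne h0 using key
  obtain ⟨hk0, e, he⟩ := h0 0 rfl
  have hka : ∀ i j l, Z.obj.d i j ≫ k j ≫ a j ≫ Z.obj.d j l ≫ k l = 0 := fun i j l => by
    by_cases hj : j = 0
    · subst hj
      rw [hk0]
      simp
    · rw [reassoc_of% (hne j hj).1]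
      simp
  have hka' : ∀ i j, Z.obj.d i j ≫ k j ≫ a j = Z.obj.d i j := fun i j => by
    by_cases hj : j = 0
    · subst hj
      by_cases hi : i + 1 = 0
      · exact (Z.property.2 i fun h => by linarith [h.1]).eq_of_src _ _
      · rw [Z.obj.shape i 0 hi, zero_comp]
    · rw [(hne j hj).1, Category.comp_id]
  let W : CochainComplex (ModuleCat.{u} A) ℤ :=
    { X := M
      d := fun i j => a i ≫ Z.obj.d i j ≫ k j
      shape := fun i j hij => by rw [Z.obj.shape i j hij]; simp
      d_comp_d' := fun i j l _ _ => by simp [hka] }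
  have hiso : ∀ i, i ≠ 0 → Nonempty (Z.obj.X i ≅ M i) := fun i hi =>
    ⟨⟨k i, a i, (hne i hi).1, (hne i hi).2⟩⟩
  have hW : projComplex A 0 n W := by
    refine ⟨fun i => ?_, fun i hi => ?_⟩
    · by_cases hi : i = 0
      · subst hi
        exact ⟨Module.Finite.equiv e.toLinearEquiv, Module.Projective.of_equiv e.toLinearEquiv⟩
      · obtain ⟨ε⟩ := hiso i hi
        obtain ⟨h₁, h₂⟩ := Z.property.1 i
        exact ⟨Module.Finite.equiv ε.toLinearEquiv, Module.Projective.of_equiv ε.toLinearEquiv⟩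
    · obtain ⟨ε⟩ := hiso i fun h => hi ⟨h.ge, by omega⟩
      exact (Z.property.2 i hi).of_iso ε.symm
  refine ⟨⟨W, hW⟩, ObjectProperty.homMk { f := a, comm' := fun i j _ => ?_ }, k, e, ?_, hne⟩
  · simp [W, hka']
  · simpa using he

end Replacement

/-! ### Left inverses in positive degrees -/

section TailMaps

variable {A : Type u} [Ring A] {n : ℤ} {X : Cplx A 1 n} {Z : Cplx A 0 n}

/-- A family of maps `Zⁱ → Xⁱ` that commutes with the differentials in degrees `≥ 1`, that is, a
morphism from the hard truncation of `Z` to `X`. -/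
def IsTailMap (r : ∀ i, Z.obj.X i →ₗ[A] X.obj.X i) : Prop :=
  ∀ i j, 1 ≤ i → i + 1 = j → ∀ z, X.obj.d i j (r i z) = r j (Z.obj.d i j z)

lemma isZero_X_of_le_zero (X : Cplx A 1 n) {i : ℤ} (hi : i ≤ 0) : IsZero (X.obj.X i) :=
  X.property.2 i fun h => by linarith [h.1]

lemma IsTailMap.mem_ker {r : ∀ i, Z.obj.X i →ₗ[A] X.obj.X i} (hr : IsTailMap r)
    (z : Z.obj.X 0) : r 1 (Z.obj.d 0 1 z) ∈ LinearMap.ker (X.obj.d 1 2).hom := by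
  refine (hr 1 2 le_rfl rfl _).trans ?_
  have h : Z.obj.d 1 2 (Z.obj.d 0 1 z) = 0 :=
    LinearMap.congr_fun (congrArg ModuleCat.Hom.hom (Z.obj.d_comp_d 0 1 2)) z
  rw [h, map_zero]

/-- Since `X⁰ = 0`, the square from degree 0 to 1 commutes exactly when `h0` holds; it is the only
obstruction to a chain map. -/
lemma isSplitMono_of_isTailMap (f : (incl A n).obj X ⟶ Z)
    {r : ∀ i, Z.obj.X i →ₗ[A] X.obj.X i} (hr : IsTailMap r)
    (hrf : ∀ i x, r i (f.hom.f i x) = x) (h0 : ∀ z, r 1 (Z.obj.d 0 1 z) = 0) :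
    IsSplitMono f := by
  refine ⟨⟨⟨ObjectProperty.homMk
    { f := fun i => ModuleCat.ofHom (r i), comm' := fun i j hij => ?_ }, ?_⟩⟩⟩
  · have hij' : i + 1 = j := hij
    rcases lt_trichotomy i 0 with hi | rfl | hi
    · exact (isZero_X_of_le_zero X (by omega)).eq_of_tgt _ _
    · obtain rfl : j = 1 := by omega
      ext z
      refine Eq.trans ?_ (h0 z).symm
      have : r 0 z = 0 :=
        (ModuleCat.subsingleton_of_isZero (isZero_X_of_le_zero X le_rfl)).elim _ _
      change X.obj.d 0 1 (r 0 z) = 0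
      rw [this, map_zero]
    · ext z
      exact hr i j hi hij' z
  · apply ObjectProperty.hom_ext
    ext i x
    exact hrf i x

/-- If `f : X ⟶ Z` is irreducible, then for every proper submodule `N` of `Z⁰` the complex `X` is a
retract, via `f`, of the complex obtained by mapping a projective module onto `N`. -/
lemma IsIrreducible.exists_isTailMap [IsNoetherianRing A] (hn : 1 ≤ n)
    {f : (incl A n).obj X ⟶ Z} (hf : IsIrreducible f)
    {N : Submodule A (Z.obj.X 0)} (hN : N ≠ ⊤) :
    ∃ r : ∀ i, Z.obj.X i →ₗ[A] X.obj.X i, IsTailMap r ∧ (∀ i x, r i (f.hom.f i x) = x) ∧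
      ∀ z ∈ N, r 1 (Z.obj.d 0 1 z) = 0 := by
  have := (Z.property.1 0).1
  obtain ⟨m, p, hp⟩ := Module.Finite.exists_fin' A N
  obtain ⟨W, h, k, e, he, hk⟩ := exists_replace_zero hn Z (P := ModuleCat.of A (Fin m → A))
    (ModuleCat.ofHom (N.subtype ∘ₗ p))
  have hX : ∀ {i : ℤ}, i ≤ 0 → IsZero (((incl A n).obj X).obj.X i) := isZero_X_of_le_zero X
  have hkd : ∀ i j, i ≠ 0 → j ≠ 0 → k i ≫ W.obj.d i j = Z.obj.d i j ≫ k j := fun i j hi hj => by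
    rw [← Category.comp_id (k i ≫ W.obj.d i j), ← (hk j hj).2, Category.assoc,
      ← h.hom.comm_assoc, reassoc_of% (hk i hi).1]
  let g : (incl A n).obj X ⟶ W := ObjectProperty.homMk
    { f := fun i => f.hom.f i ≫ k i
      comm' := fun i j hij => by
        have hij' : i + 1 = j := hij
        by_cases hi : i ≤ 0
        · exact (hX hi).eq_of_src _ _
        · rw [Category.assoc, hkd i j (by omega) (by omega), f.hom.comm_assoc] }
  have hgh : g ≫ h = f := by
    apply ObjectProperty.hom_ext
    ext1 i
    by_cases hi : i ≤ 0
    · exact (hX hi).eq_of_src _ _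
    · change (f.hom.f i ≫ k i) ≫ h.hom.f i = _
      rw [Category.assoc, (hk i (by omega)).1, Category.comp_id]
  rcases hf.factor g h hgh with ⟨⟨⟨ρ⟩⟩⟩ | ⟨⟨⟨σ⟩⟩⟩
  · let s := ρ.retraction
    have hs : ∀ i, f.hom.f i ≫ k i ≫ s.hom.f i = 𝟙 _ := fun i => by
      have := congrArg (fun t => t.hom.f i) ρ.id
      rw [← Category.assoc]
      exact this
    refine ⟨fun i => (k i ≫ s.hom.f i).hom, fun i j hi hij z => ?_, fun i x => ?_, ?_⟩
    · have : (k i ≫ s.hom.f i) ≫ X.obj.d i j = Z.obj.d i j ≫ k j ≫ s.hom.f j := by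
        rw [← Category.assoc (Z.obj.d i j), ← hkd i j (by omega) (by omega), Category.assoc,
          Category.assoc]
        exact congrArg _ (s.hom.comm i j)
      exact LinearMap.congr_fun (congrArg ModuleCat.Hom.hom this) z
    · exact LinearMap.congr_fun (congrArg ModuleCat.Hom.hom (hs i)) x
    · intro z hz
      obtain ⟨y, hy⟩ := hp ⟨z, hz⟩
      -- By the chain map equation for `s`, this composite factors through `X⁰ = 0`.
      have hzero : ModuleCat.ofHom (N.subtype ∘ₗ p) ≫ Z.obj.d 0 1 ≫ k 1 ≫ s.hom.f 1 = 0 := by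
        rw [← he, Category.assoc, h.hom.comm_assoc, reassoc_of% (hk 1 one_ne_zero).2,
          ← s.hom.comm, (hX le_rfl).eq_of_tgt (s.hom.f 0) 0, zero_comp, comp_zero]
      have hyz : (N.subtype ∘ₗ p) y = z := by
        rw [LinearMap.comp_apply, hy]; rfl
      have := LinearMap.congr_fun (congrArg ModuleCat.Hom.hom hzero) y
      rw [← hyz]
      exact this
  -- A section of `h` would factor the identity of `Z⁰` through `N`.
  · refine absurd (eq_top_iff.2 fun z _ => ?_) hN
    have hσ : σ.section_.hom.f 0 ≫ e.inv ≫ ModuleCat.ofHom (N.subtype ∘ₗ p) = 𝟙 _ := by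
      rw [← he, e.inv_hom_id_assoc]
      exact congrArg (fun t => t.hom.f 0) σ.id
    have hz := LinearMap.congr_fun (congrArg ModuleCat.Hom.hom hσ) z
    rw [← show _ = z from hz]
    exact (p _).2

end TailMaps

/-- If `f : X ⟶ Z` is irreducible, with `X` in `C_n(proj A)` and `Z` in `C_[0,n](proj A)`, then the
top of `Z⁰` is a quotient of the socle of the kernel of `X¹ ⟶ X²`. -/
theorem IsIrreducible.exists_surjective_socKer {R : Type v} [CommRing R] [IsArtinianRing R]
    {A : Type u} [Ring A] [Algebra R A] [Module.Finite R A] {n : ℤ} (hn : 1 ≤ n)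
    {X : Cplx A 1 n} {Z : Cplx A 0 n} {f : (incl A n).obj X ⟶ Z} (hf : IsIrreducible f) :
    ∃ s : socKer X →ₗ[A] Z.obj.X 0 ⧸ Module.jacobson A (Z.obj.X 0), Function.Surjective s := by
  have : IsArtinianRing A := IsArtinianRing.of_finite R A
  let _ : ∀ M : ModuleCat.{u} A, Module R M := fun M => Module.restrictScalars R A M
  have : ∀ M : ModuleCat.{u} A, IsScalarTower R A M := fun M => IsScalarTower.restrictScalars R A M
  have := (Z.property.1 0).1
  have := (X.property.1 1).1
  let K := LinearMap.ker (X.obj.d 1 2).hom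
  -- Direction of the coset `Φ`: differences of left inverses of `f` vanish on the image of `f`.
  let H : Submodule R (Z.obj.X 0 →ₗ[A] K) :=
    { carrier := {ψ | ∃ r : ∀ i, Z.obj.X i →ₗ[A] X.obj.X i, IsTailMap r ∧
        (∀ i x, r i (f.hom.f i x) = 0) ∧ ∀ z, (ψ z : X.obj.X 1) = r 1 (Z.obj.d 0 1 z)}
      zero_mem' := ⟨0, fun i j _ _ z => map_zero _, fun _ _ => rfl, fun _ => rfl⟩
      add_mem' := by
        rintro ψ ψ' ⟨r, hr, hrf, hψ⟩ ⟨r', hr', hrf', hψ'⟩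
        exact ⟨r + r', fun i j hi hij z => by simp [hr i j hi hij, hr' i j hi hij],
          fun i x => by simp [hrf, hrf'], fun z => by simp [hψ, hψ']⟩
      smul_mem' := by
        rintro c ψ ⟨r, hr, hrf, hψ⟩
        refine ⟨c • r, fun i j hi hij z => ?_, fun i x => ?_, fun z => ?_⟩
        · rw [Pi.smul_apply, Pi.smul_apply, LinearMap.smul_apply, LinearMap.smul_apply,
            ← hr i j hi hij]
          exact (X.obj.d i j).hom.map_smul_of_tower c _
        · rw [Pi.smul_apply, LinearMap.smul_apply, hrf, smul_zero]
        · change _ = c • r 1 _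
          rw [← hψ]
          rfl }
  refine exists_surjective_socle_quotient_jacobson (R := R) (K := K) H
    {φ | ∃ r : ∀ i, Z.obj.X i →ₗ[A] X.obj.X i, IsTailMap r ∧
      (∀ i x, r i (f.hom.f i x) = x) ∧ ∀ z, (φ z : X.obj.X 1) = r 1 (Z.obj.d 0 1 z)} ?_ ?_ ?_ ?_
  · rintro ⟨r, hr, hrf, h0⟩
    exact hf.not_section (isSplitMono_of_isTailMap f hr hrf fun z => (h0 z).symm)
  · rintro φ ⟨r, hr, hrf, hφ⟩ ψ ⟨r', hr', hrf', hψ⟩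
    exact ⟨r - r', fun i j hi hij z => by simp [hr i j hi hij, hr' i j hi hij],
      fun i x => by simp [hrf, hrf'], fun z => by simp [hφ, hψ]⟩
  · rintro φ ⟨r, hr, hrf, hφ⟩ ψ ⟨r', hr', hrf', hψ⟩
    exact ⟨r - r', fun i j hi hij z => by simp [hr i j hi hij, hr' i j hi hij],
      fun i x => by simp [hrf, hrf'], fun z => by simp [hφ, hψ]⟩
  · intro N hN
    obtain ⟨r, hr, hrf, hrN⟩ := hf.exists_isTailMap hn hN
    exact ⟨(r 1 ∘ₗ (Z.obj.d 0 1).hom).codRestrict K hr.mem_ker, ⟨r, hr, hrf, fun _ => rfl⟩,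
      fun z hz => Subtype.ext (hrN z hz)⟩

end ProjComplexes

theorem proposition4p1 {R : Type v} [CommRing R] [IsArtinianRing R]
    {A : Type u} [Ring A] [Algebra R A] [Module.Finite R A]
    (n : ℤ) (hn : 1 ≤ n)
    (X Y : ProjComplexes.Cplx A 1 n) (hX : Indecomposable X)
    (Z : ProjComplexes.Cplx A 0 n) (hZ : ProjComplexes.IsLeftEnlargement X Z)
    (D : ProjComplexes.DiagonalForm X Y Z)
    (f : (ProjComplexes.incl A n).obj X ⟶ Z) (hf : ProjComplexes.IsIrreducible f) :
    (∃ (P : ModuleCat.{u} A) (π : P →ₗ[A] ProjComplexes.socKer X),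
      ProjComplexes.IsProjectiveCover π) ∧
    ∀ (P : ModuleCat.{u} A) (π : P →ₗ[A] ProjComplexes.socKer X),
      ProjComplexes.IsProjectiveCover π →
        ProjComplexes.IsDirectSummand (Z.obj.X 0) P := by
  have : IsArtinianRing A := IsArtinianRing.of_finite R A
  have := (X.property.1 1).1
  have := (Z.property.1 0).1
  have := (Z.property.1 0).2
  refine ⟨ProjComplexes.exists_isProjectiveCover, fun P π hπ => ?_⟩
  have := hπ.projective
  obtain ⟨s, hs⟩ := hf.exists_surjective_socKer (R := R) hn
  exact ProjComplexes.isDirectSummand_of_surjective_quotient_jacobson (s ∘ₗ π)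
    (hs.comp hπ.surjective)
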